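/- Write a permutation $p\in S_n$ in one-line notation $p=p_1p_2\cdots p_n$. Say that $p$ avoids $123$ if there are no indices $i<j<k$ with $p_i<p_j<p_k$. Call $p$ (skew-)decomposable if there is an integer $k$ with $1\le k<n$ such that $p_i>p_j$ for all $i\le k$ and all $j>k$, and (skew-)indecomposable otherwise. Let $\mathrm{Av}_n^*(123)$ be the set of indecomposable permutations in $S_n$ that avoid $123$, and let $c_m=\frac{1}{m+1}\binom{2m}{m}$ denote the $m$th Catalan number. Proposition. For all $n\ge 1$, $$|\mathrm{Av}_n^*(123)|=\frac1n\binom{2n-2}{n-1}=c_{n-1}.$$ -/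

import Mathlib

namespace PermPattern

/-- The permutation `p` of length `n` contains `q` of length `k` as a pattern: there are positions
`f 0 < f 1 < ⋯ < f (k - 1)` at which the entries of `p` are in the same relative order as the
entries of `q`. Permutations are in one-line notation `p 0, p 1, …, p (n - 1)`, 0-indexed. -/
def Contains {n k : ℕ} (p : Equiv.Perm (Fin n)) (q : Equiv.Perm (Fin k)) : Prop :=
  ∃ f : Fin k ↪o Fin n, ∀ a b : Fin k, q a < q b ↔ p (f a) < p (f b)

/-- `p` avoids `q`. -/
def Avoids {n k : ℕ} (p : Equiv.Perm (Fin n)) (q : Equiv.Perm (Fin k)) : Prop :=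
  ¬ Contains p q

/-- The pattern `123`, i.e. the identity permutation of length three. -/
def pattern123 : Equiv.Perm (Fin 3) := 1

/-- `p` is (skew-)decomposable: for some `1 ≤ k < n`, each of the first `k` entries of `p` is larger
than each of the remaining `n - k` entries. -/
def Decomposable {n : ℕ} (p : Equiv.Perm (Fin n)) : Prop :=
  ∃ k : ℕ, 1 ≤ k ∧ k < n ∧ ∀ i j : Fin n, (i : ℕ) < k → k ≤ (j : ℕ) → p j < p i

/-- `p` is (skew-)indecomposable. -/
def Indecomposable {n : ℕ} (p : Equiv.Perm (Fin n)) : Prop :=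
  ¬ Decomposable p

/-- The set of permutations of length `n` avoiding `q`. -/
def Av {k : ℕ} (q : Equiv.Perm (Fin k)) (n : ℕ) : Set (Equiv.Perm (Fin n)) :=
  {p | Avoids p q}

/-- The set of indecomposable permutations of length `n` avoiding `q`. -/
def AvStar {k : ℕ} (q : Equiv.Perm (Fin k)) (n : ℕ) : Set (Equiv.Perm (Fin n)) :=
  {p | p ∈ Av q n ∧ Indecomposable p}

end PermPattern

/-!
A permutation avoids `123` exactly when its entries other than the left-to-right minima decrease.
It is therefore determined by the positions and values of these minima, that is, by its running
minimum, since the remaining values must fill the remaining positions in decreasing order. An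
antitone sequence `m` arises as a running minimum if and only if `m i ≤ n - 1 - i` for all `i`.
The permutation is decomposable after position `i` if and only if equality holds there: the first
`i + 1` entries are then the `i + 1` largest ones. So the indecomposable permutations correspond
to the antitone sequences with `m i ≤ n - 2 - i` for `i < n - 1` and `m (n - 1) = 0`. Imposing a
bound `c` on the first term gives a recurrence of Pascal type, which is solved by the ballot numbers
`(n + c).choose n - (n + c).choose (n + 1)`; the Catalan numbers are the case `c = n`.
-/

namespace PermPattern

open Finset

section RunMin

variable {ι α : Type*}

/-- `i` is (the position of) a left-to-right minimum of the sequence `f` if `f i` is strictly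
smaller than all earlier terms. -/
def IsLeftToRightMin [LT ι] [LT α] (f : ι → α) (i : ι) : Prop :=
  ∀ j < i, f i < f j

lemma injOn_isLeftToRightMin [LinearOrder ι] [Preorder α] (f : ι → α) :
    Set.InjOn f {i | IsLeftToRightMin f i} := by
  intro i hi j hj hij
  by_contra hne
  rcases lt_or_gt_of_ne hne with h | h
  exacts [(hj i h).ne' hij, (hi j h).ne hij]

lemma strictAntiOn_not_isLeftToRightMin_iff [Preorder ι] [LinearOrder α] {f : ι → α}
    (hf : Function.Injective f) :
    StrictAntiOn f {i | ¬ IsLeftToRightMin f i} ↔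
      ∀ i j k, i < j → j < k → f i < f j → ¬ f j < f k := by
  constructor
  · intro h i j k hij hjk hfij hfjk
    exact (h (fun hj => hfij.asymm (hj i hij))
      (fun hk => hfjk.asymm (hk j hjk)) hjk).asymm hfjk
  · intro h j hj k _ hjk
    obtain ⟨i, hij, hfij⟩ : ∃ i < j, f i ≤ f j := by simpa [IsLeftToRightMin] using hj
    exact (not_lt.mp (h i j k hij hjk (hfij.lt_of_ne (hf.ne hij.ne)))).lt_of_ne (hf.ne hjk.ne')

section SemilatticeInf

variable [Preorder ι] [LocallyFiniteOrderBot ι] [SemilatticeInf α] {f : ι → α} {i j : ι} {a : α}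

/-- The running minimum of `f`: the sequence whose value at `i` is the infimum of the `f j` with
`j ≤ i`. It is the order dual of `partialSups`. -/
def runMin (f : ι → α) (i : ι) : α :=
  (Iic i).inf' nonempty_Iic f

lemma le_runMin_iff : a ≤ runMin f i ↔ ∀ j ≤ i, a ≤ f j := by
  simp [runMin]

lemma runMin_le (hji : j ≤ i) : runMin f i ≤ f j :=
  le_runMin_iff.mp le_rfl j hji

lemma antitone_runMin (f : ι → α) : Antitone (runMin f) :=
  fun _ _ hij => le_runMin_iff.mpr fun _ hk => runMin_le (hk.trans hij)

lemma runMin_eq_of_antitone (hf : Antitone f) : runMin f = f :=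
  funext fun _ => (runMin_le le_rfl).antisymm (le_runMin_iff.mpr fun _ hj => hf hj)

end SemilatticeInf

section LinearOrder

variable [PartialOrder ι] [LocallyFiniteOrderBot ι] [LinearOrder α] {f : ι → α} {i : ι} {a : α}

lemma lt_runMin_iff : a < runMin f i ↔ ∀ j ≤ i, a < f j := by
  simp [runMin]

lemma exists_isLeftToRightMin_eq_runMin (f : ι → α) (i : ι) :
    ∃ j ≤ i, IsLeftToRightMin f j ∧ f j = runMin f i := by
  obtain ⟨k, hki, hk⟩ := exists_mem_eq_inf' (s := Iic i) nonempty_Iic f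
  obtain ⟨j, hj⟩ :=
    exists_minimal (s := {j ∈ Iic i | f j = runMin f i}) ⟨k, mem_filter.mpr ⟨hki, hk.symm⟩⟩
  simp only [Minimal, mem_filter, mem_Iic] at hj
  obtain ⟨⟨hji, hfj⟩, hmin⟩ := hj
  refine ⟨j, hji, fun l hl => ?_, hfj⟩
  have hli : l ≤ i := hl.le.trans hji
  rw [hfj]
  exact (runMin_le hli).lt_of_ne fun h => hl.not_ge (hmin ⟨hli, h.symm⟩ hl.le)

lemma IsLeftToRightMin.runMin_eq (hi : IsLeftToRightMin f i) : runMin f i = f i :=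
  (runMin_le le_rfl).antisymm <| le_runMin_iff.mpr fun j hj =>
    hj.eq_or_lt.elim (fun h => h ▸ le_rfl) fun h => (hi j h).le

lemma isLeftToRightMin_runMin_iff : IsLeftToRightMin (runMin f) i ↔ IsLeftToRightMin f i := by
  constructor
  · intro h
    obtain ⟨j, hji, hj, hfj⟩ := exists_isLeftToRightMin_eq_runMin f i
    rcases hji.eq_or_lt with rfl | hlt
    · exact hj
    · exact absurd (hj.runMin_eq.trans hfj) (h j hlt).ne'
  · intro h j hji
    rw [h.runMin_eq]
    exact lt_runMin_iff.mpr fun k hk => h k (hk.trans_lt hji)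

end LinearOrder

end RunMin

section Perm

variable {α : Type*} [LinearOrder α] {s : Set α}

lemma eqOn_of_strictAntiOn_of_image_eq [WellFoundedGT α] {β : Type*} [PartialOrder β]
    {f g : α → β} (hf : StrictAntiOn f s) (hg : StrictAntiOn g s) (hfg : f '' s = g '' s) :
    Set.EqOn f g s := by
  have hf' : StrictAnti (s.domRestrict f) := fun i j hij => hf i.2 j.2 hij
  have hg' : StrictAnti (s.domRestrict g) := fun i j hij => hg i.2 j.2 hij
  rw [← Set.range_domRestrict, ← Set.range_domRestrict, hf'.range_inj hg'] at hfg
  exact fun i hi => congrFun hfg ⟨i, hi⟩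

lemma perm_eq_of_eqOn_of_strictAntiOn_compl [WellFoundedGT α] {p q : Equiv.Perm α}
    (hpq : Set.EqOn p q s) (hp : StrictAntiOn p sᶜ) (hq : StrictAntiOn q sᶜ) : p = q := by
  have himage : p '' sᶜ = q '' sᶜ := by
    rw [Set.image_compl_eq p.bijective, Set.image_compl_eq q.bijective, hpq.image_eq]
  have hcompl := eqOn_of_strictAntiOn_of_image_eq hp hq himage
  refine Equiv.ext fun i => ?_
  by_cases hi : i ∈ s
  exacts [hpq hi, hcompl hi]

lemma exists_perm_eqOn_strictAntiOn_compl [Finite α] {f : α → α} (hf : Set.InjOn f s) :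
    ∃ p : Equiv.Perm α, Set.EqOn p f s ∧ StrictAntiOn p sᶜ := by
  classical
  have := Fintype.ofFinite α
  let onS : s ≃ f '' s := Equiv.Set.imageOfInjOn f s hf
  have hcard : Fintype.card {i // i ∉ s} = Fintype.card {v // v ∉ f '' s} :=
    Fintype.card_compl_eq_card_compl _ _ (Fintype.card_congr onS)
  let offS : {i // i ∉ s} ≃o {v // v ∉ f '' s}ᵒᵈ :=
    (Fintype.orderIsoFinOfCardEq _ hcard).symm.trans (Fintype.orderIsoFinOfCardEq _ rfl)
  refine ⟨Equiv.subtypeCongr onS (offS.toEquiv.trans OrderDual.ofDual), fun i hi => ?_,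
    fun i hi j hj hij => ?_⟩
  · simp [Equiv.subtypeCongr, hi, onS, Equiv.Set.imageOfInjOn]
  · have hlt := offS.strictMono (show (⟨i, hi⟩ : {i // i ∉ s}) < ⟨j, hj⟩ from hij)
    have hi' : i ∉ s := hi
    have hj' : j ∉ s := hj
    simpa [Equiv.subtypeCongr, hi', hj'] using hlt

end Perm

section Fin

variable {n : ℕ} {f : Fin n → Fin n} {p : Equiv.Perm (Fin n)} {i v : Fin n}

lemma le_rev_of_forall_le (hf : Function.Injective f) (h : ∀ j ≤ i, v ≤ f j) : v ≤ i.rev := by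
  have hcard : #(Iic i) ≤ #(Ici v) :=
    card_le_card_of_injOn f (fun j hj => by simpa using h j (by simpa using hj)) hf.injOn
  rw [Fin.card_Iic, Fin.card_Ici] at hcard
  rw [Fin.le_def, Fin.val_rev]
  omega

lemma rev_lt_of_forall_lt (hf : Function.Injective f) (h : ∀ j ≥ i, f j < v) : i.rev < v := by
  have hcard : #(Ici i) ≤ #(Iio v) :=
    card_le_card_of_injOn f (fun j hj => by simpa using h j (by simpa using hj)) hf.injOn
  rw [Fin.card_Ici, Fin.card_Iio] at hcard
  rw [Fin.lt_def, Fin.val_rev]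
  omega

lemma runMin_le_rev (hf : Function.Injective f) (i : Fin n) : runMin f i ≤ i.rev :=
  le_rev_of_forall_le hf fun _ => runMin_le

lemma le_iff_rev_le_of_forall_rev_le (h : ∀ j ≤ i, i.rev ≤ p j) (j : Fin n) :
    j ≤ i ↔ i.rev ≤ p j := by
  have himage : (Iic i).map p.toEmbedding = Ici i.rev := by
    refine eq_of_subset_of_card_le (fun v hv => ?_) ?_
    · obtain ⟨k, hk, rfl⟩ := mem_map.mp hv
      exact mem_Ici.mpr (h k (mem_Iic.mp hk))
    · rw [card_map, Fin.card_Iic, Fin.card_Ici, Fin.val_rev]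
      omega
  rw [← mem_Ici (a := i.rev), ← himage]
  simp

lemma mem_Av_pattern123_iff :
    p ∈ Av pattern123 n ↔ ∀ i j k, i < j → j < k → p i < p j → ¬ p j < p k := by
  constructor
  · intro h i j k hij hjk hpij hpjk
    have hpos : StrictMono ![i, j, k] := by
      simp [Fin.strictMono_iff_lt_succ, Fin.forall_fin_two, hij, hjk]
    have hval : StrictMono (p ∘ ![i, j, k]) := by
      simp [Fin.strictMono_iff_lt_succ, Fin.forall_fin_two, hpij, hpjk]
    exact h ⟨OrderEmbedding.ofStrictMono _ hpos, fun _ _ => hval.lt_iff_lt.symm⟩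
  · rintro h ⟨f, hf⟩
    exact h (f 0) (f 1) (f 2) (f.strictMono (by decide)) (f.strictMono (by decide))
      ((hf 0 1).mp (by decide)) ((hf 1 2).mp (by decide))

lemma mem_Av_pattern123_iff_strictAntiOn :
    p ∈ Av pattern123 n ↔ StrictAntiOn p {i | IsLeftToRightMin p i}ᶜ :=
  mem_Av_pattern123_iff.trans (strictAntiOn_not_isLeftToRightMin_iff p.injective).symm

lemma injOn_runMin_Av_pattern123 (n : ℕ) :
    Set.InjOn (fun p : Equiv.Perm (Fin n) => runMin p) (Av pattern123 n) := by
  intro p hp q hq (hpq : runMin p = runMin q)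
  have hmin (i : Fin n) : IsLeftToRightMin p i ↔ IsLeftToRightMin q i := by
    rw [← isLeftToRightMin_runMin_iff, hpq, isLeftToRightMin_runMin_iff]
  rw [mem_Av_pattern123_iff_strictAntiOn] at hp hq
  simp only [← hmin] at hq
  refine perm_eq_of_eqOn_of_strictAntiOn_compl (fun i hi => ?_) hp hq
  rw [← hi.runMin_eq, hpq, ((hmin i).mp hi).runMin_eq]

lemma le_perm_of_le_rev {m : Fin n → Fin n} (hm : ∀ i, m i ≤ i.rev)
    (hp : Set.EqOn p m {i | IsLeftToRightMin m i})
    (hanti : StrictAntiOn p {i | IsLeftToRightMin m i}ᶜ) (i : Fin n) : m i ≤ p i := by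
  by_cases hi : IsLeftToRightMin m i
  · exact (hp hi).ge
  by_contra! hlt
  -- Otherwise all `n - i` entries from position `i` on are among the `m i` values below `m i`.
  refine (hm i).not_gt (rev_lt_of_forall_lt p.injective fun j (hij : i ≤ j) => ?_)
  by_cases hj : IsLeftToRightMin m j
  · rw [hp hj]
    exact hj i (hij.lt_of_ne fun h => hi (h ▸ hj))
  · exact (hanti.antitoneOn hi hj hij).trans_lt hlt

lemma exists_mem_Av_pattern123_runMin_eq {m : Fin n → Fin n} (hm : Antitone m)
    (hrev : ∀ i, m i ≤ i.rev) : ∃ p ∈ Av pattern123 n, runMin p = m := by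
  obtain ⟨p, hp, hanti⟩ := exists_perm_eqOn_strictAntiOn_compl (injOn_isLeftToRightMin m)
  have hle := le_perm_of_le_rev hrev hp hanti
  refine ⟨p, mem_Av_pattern123_iff_strictAntiOn.mpr (hanti.mono ?_), funext fun i => ?_⟩
  · refine Set.compl_subset_compl.mpr fun i hi j hj => ?_
    rw [hp hi]
    exact (hi j hj).trans_le (hle j)
  · refine le_antisymm ?_ (le_runMin_iff.mpr fun j hj => (hm hj).trans (hle j))
    obtain ⟨j, hji, hj, hmj⟩ := exists_isLeftToRightMin_eq_runMin m i
    rw [← congrFun (runMin_eq_of_antitone hm) i, ← hmj, ← hp hj]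
    exact runMin_le hji

lemma bijOn_runMin_Av_pattern123 (n : ℕ) :
    Set.BijOn (fun p : Equiv.Perm (Fin n) => runMin p) (Av pattern123 n)
      {m | Antitone m ∧ ∀ i, m i ≤ i.rev} :=
  ⟨fun p _ => ⟨antitone_runMin p, runMin_le_rev p.injective⟩, injOn_runMin_Av_pattern123 n,
    fun _ ⟨hm, hrev⟩ => exists_mem_Av_pattern123_runMin_eq hm hrev⟩

lemma decomposable_iff_exists_rev_le_runMin :
    Decomposable p ↔ ∃ i : Fin n, (i : ℕ) + 1 < n ∧ i.rev ≤ runMin p i := by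
  constructor
  · rintro ⟨k, hk, hkn, hdec⟩
    refine ⟨⟨k - 1, by omega⟩, show k - 1 + 1 < n by omega,
      le_runMin_iff.mpr fun a (ha : (a : ℕ) ≤ k - 1) => ?_⟩
    have hlt : Fin.rev ⟨k, hkn⟩ < p a :=
      rev_lt_of_forall_lt p.injective fun j hj => hdec a j (by omega) hj
    simp only [Fin.lt_def, Fin.le_def, Fin.val_rev] at hlt ⊢
    omega
  · rintro ⟨i, hin, hi⟩
    have hiff := le_iff_rev_le_of_forall_rev_le (le_runMin_iff.mp hi)
    refine ⟨i + 1, by omega, hin, fun a b ha hb => ?_⟩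
    have hb' : ¬ i.rev ≤ p b := by rw [← hiff, Fin.le_def]; omega
    exact (not_le.mp hb').trans_le ((hiff a).mp (Fin.le_def.mpr (by omega)))

lemma indecomposable_iff_runMin_le :
    Indecomposable p ↔ ∀ i : Fin n, ((runMin p i : Fin n) : ℕ) ≤ (i.rev : ℕ) - 1 := by
  rw [Indecomposable, decomposable_iff_exists_rev_le_runMin, not_exists]
  refine forall_congr' fun i => ?_
  have hle := Fin.le_def.mp (runMin_le_rev p.injective i)
  rw [Fin.le_def]
  rw [Fin.val_rev] at hle ⊢
  omega

lemma bijOn_runMin_AvStar_pattern123 (n : ℕ) :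
    Set.BijOn (fun p : Equiv.Perm (Fin n) => runMin p) (AvStar pattern123 n)
      {m | Antitone m ∧ ∀ i, (m i : ℕ) ≤ (i.rev : ℕ) - 1} := by
  have hsub : {m : Fin n → Fin n | Antitone m ∧ ∀ i, (m i : ℕ) ≤ (i.rev : ℕ) - 1} ⊆
      {m | Antitone m ∧ ∀ i, m i ≤ i.rev} :=
    fun m ⟨hm, hle⟩ => ⟨hm, fun i => Fin.le_def.mpr ((hle i).trans (Nat.sub_le _ _))⟩
  convert (bijOn_runMin_Av_pattern123 n).subset_right hsub using 1
  ext p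
  simp only [AvStar, indecomposable_iff_runMin_le, antitone_runMin, Set.mem_inter_iff,
    Set.mem_preimage, Set.mem_ofPred_eq, true_and]

end Fin

section Staircase

open Matrix

/-- The antitone sequences of length `n + 1` that lie below the staircase `n - 1, …, 1, 0, 0` and
are bounded by `c`. The subtraction is truncated, so that the last bound is `0` as well. -/
def staircaseSeq (n c : ℕ) : Set (Fin (n + 1) → ℕ) :=
  {m | Antitone m ∧ ∀ i, m i ≤ (i.rev : ℕ) - 1 ∧ m i ≤ c}

variable {n c a : ℕ}

lemma finite_staircaseSeq (n c : ℕ) : (staircaseSeq n c).Finite :=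
  (Set.finite_Iic fun _ => c).subset fun _ hm i => (hm.2 i).2

lemma staircaseSeq_zero_right (n : ℕ) : staircaseSeq n 0 = {0} := by
  ext m
  constructor
  · exact fun hm => funext fun i => Nat.le_zero.mp (hm.2 i).2
  · rintro rfl
    exact ⟨antitone_const, fun i => ⟨Nat.zero_le _, le_rfl⟩⟩

lemma vecCons_mem_staircaseSeq_iff {m : Fin (n + 1) → ℕ} :
    vecCons a m ∈ staircaseSeq (n + 1) c ↔ a ≤ n ∧ a ≤ c ∧ m ∈ staircaseSeq n a := by
  simp only [staircaseSeq, Set.mem_ofPred_eq, antitone_vecCons, Fin.forall_fin_succ (n := n + 1),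
    cons_val_zero, cons_val_succ]
  constructor
  · rintro ⟨⟨h0, hm⟩, ⟨hn, hc⟩, hle⟩
    exact ⟨by simpa using hn, hc, hm, fun i => ⟨by simpa using (hle i).1, (hm i.zero_le).trans h0⟩⟩
  · rintro ⟨hn, hc, hm, hle⟩
    exact ⟨⟨(hle 0).2, hm⟩, ⟨by simpa using hn, hc⟩,
      fun i => ⟨by simpa using (hle i).1, (hle i).2.trans hc⟩⟩

lemma staircaseSeq_succ_of_le (hc : n ≤ c + 1) : staircaseSeq n (c + 1) = staircaseSeq n c := by
  ext m
  refine and_congr_right fun _ => forall_congr' fun i => ?_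
  rw [Fin.val_rev]
  omega

lemma staircaseSeq_succ_succ (hc : c < n) :
    staircaseSeq (n + 1) (c + 1) =
      staircaseSeq (n + 1) c ∪ vecCons (c + 1) '' staircaseSeq n (c + 1) := by
  ext m
  obtain ⟨a, m, rfl⟩ : ∃ a m', m = vecCons a m' := ⟨_, _, (cons_head_tail m).symm⟩
  simp only [Set.mem_union, Set.mem_image, vecCons_mem_staircaseSeq_iff, vecCons_inj]
  constructor
  · rintro ⟨hn, ha, hm⟩
    rcases Nat.le_succ_iff.mp ha with ha | rfl
    exacts [.inl ⟨hn, ha, hm⟩, .inr ⟨m, hm, rfl, rfl⟩]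
  · rintro (⟨hn, ha, hm⟩ | ⟨_, hm, rfl, rfl⟩)
    exacts [⟨hn, ha.trans c.le_succ, hm⟩, ⟨hc, le_rfl, hm⟩]

lemma ncard_staircaseSeq_succ_succ (hc : c < n) :
    (staircaseSeq (n + 1) (c + 1)).ncard =
      (staircaseSeq (n + 1) c).ncard + (staircaseSeq n (c + 1)).ncard := by
  have hdisj : Disjoint (staircaseSeq (n + 1) c) (vecCons (c + 1) '' staircaseSeq n (c + 1)) := by
    rw [Set.disjoint_right]
    rintro _ ⟨m, -, rfl⟩ hm
    exact Nat.not_succ_le_self c (vecCons_mem_staircaseSeq_iff.mp hm).2.1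
  rw [staircaseSeq_succ_succ hc, Set.ncard_union_eq hdisj (finite_staircaseSeq _ _)
    ((finite_staircaseSeq _ _).image _),
    Set.ncard_image_of_injective _ fun _ _ h => (vecCons_inj.mp h).2]

lemma ncard_staircaseSeq_add_choose (hc : c ≤ n) :
    (staircaseSeq n c).ncard + (n + c).choose (n + 1) = (n + c).choose n := by
  induction n generalizing c with
  | zero =>
    obtain rfl := Nat.le_zero.mp hc
    simp [staircaseSeq_zero_right]
  | succ n ihn =>
    induction c with
    | zero => simp [staircaseSeq_zero_right]
    | succ c ihc =>
      specialize ihc (by omega)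
      rw [← Nat.add_assoc, Nat.choose_succ_succ' _ n, Nat.choose_succ_succ' _ (n + 1)]
      rcases hc.lt_or_eq with hlt | heq
      · specialize ihn (Nat.lt_succ_iff.mp hlt)
        rw [ncard_staircaseSeq_succ_succ (by omega)]
        rw [show n + (c + 1) = n + 1 + c by omega] at ihn
        omega
      · obtain rfl : c = n := by omega
        have hsymm : (c + 1 + c).choose c = (c + 1 + c).choose (c + 1) :=
          Nat.choose_symm_of_eq_add (by omega)
        rw [staircaseSeq_succ_of_le le_rfl]
        omega

lemma ncard_staircaseSeq_self (n : ℕ) : (staircaseSeq n n).ncard = catalan n := by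
  have hballot : ((staircaseSeq n n).ncard + (n + n).choose (n + 1)) * (n + 1) =
      (n + n).choose n * (n + 1) := by
    rw [ncard_staircaseSeq_add_choose le_rfl]
  have hchoose : (n + n).choose (n + 1) * (n + 1) = (n + n).choose n * n := by
    simpa using Nat.choose_succ_right_eq (n + n) n
  have hcatalan := succ_mul_catalan_eq_centralBinom n
  rw [Nat.centralBinom_eq_two_mul_choose, two_mul] at hcatalan
  apply Nat.eq_of_mul_eq_mul_left n.succ_pos
  rw [Nat.succ_eq_add_one, hcatalan]
  linarith

lemma bijOn_val_staircaseSeq (n : ℕ) :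
    Set.BijOn (fun m : Fin (n + 1) → Fin (n + 1) => fun i => (m i : ℕ))
      {m | Antitone m ∧ ∀ i, (m i : ℕ) ≤ (i.rev : ℕ) - 1} (staircaseSeq n n) := by
  refine ⟨fun m ⟨hm, hle⟩ => ⟨fun i j hij => hm hij, fun i => ⟨hle i, (m i).is_le⟩⟩,
    (Fin.val_injective.comp_left).injOn, fun m ⟨hm, hle⟩ => ?_⟩
  exact ⟨fun i => ⟨m i, Nat.lt_succ_iff.mpr (hle i).2⟩,
    ⟨fun i j hij => hm hij, fun i => (hle i).1⟩, rfl⟩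

end Staircase

lemma ncard_AvStar_pattern123 (n : ℕ) : (AvStar pattern123 (n + 1)).ncard = catalan n := by
  rw [(bijOn_runMin_AvStar_pattern123 (n + 1)).ncard_eq, (bijOn_val_staircaseSeq n).ncard_eq,
    ncard_staircaseSeq_self]

end PermPattern

theorem mainTheorem8 (n : ℕ) (hn : 1 ≤ n) :
    ((PermPattern.AvStar PermPattern.pattern123 n).ncard : ℚ)
        = 1 / (n : ℚ) * ((2 * n - 2).choose (n - 1) : ℚ) ∧
      (PermPattern.AvStar PermPattern.pattern123 n).ncard = catalan (n - 1) := by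
  obtain ⟨n, rfl⟩ := Nat.exists_eq_add_of_le' hn
  have hcard := PermPattern.ncard_AvStar_pattern123 n
  have hcatalan : ((2 * n).choose n : ℚ) = (n + 1) * catalan n := by
    rw [← Nat.centralBinom_eq_two_mul_choose]
    exact_mod_cast (succ_mul_catalan_eq_centralBinom n).symm
  refine ⟨?_, hcard⟩
  rw [hcard, show 2 * (n + 1) - 2 = 2 * n by omega, Nat.add_sub_cancel, hcatalan]
  push_cast
  field_simp
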